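/- Let $\mathbb K$ be $\mathbb R$ or $\mathbb C$, let $S$ be a finite ordered set, and let $\mathcal M$ be a matroid on $S$ of rank $n$. Let $E$ be a $\mathbb K$-vector space with basis $(e_i)_{i\in S}$, and let $\mathrm R:E\to F$ be a linear map to a $\mathbb K$-vector space $F$ which represents $\mathcal M$: a set $I\subset S$ is independent if and only if the family $(\mathrm R(e_i))_{i\in I}$ is linearly independent. Let $\mathrm D:F^*\to E^*$ be the transpose of $\mathrm R$, and $Z=\ker \mathrm R$, of dimension $b$. Let $x=(x_i)_{i\in S}$ be positive real weights, and endow $E^*$ with the inner product $\langle u,v\rangle=\sum_{i\in S}x_i\,\overline{u(e_i)}\,v(e_i)$, for which the dual basis $(e_i^\star)_{i\in S}$ is orthogonal. For $k\ge 0$ let $\mathcal B_k$ be the set of subsets $K\subset S$ of cardinality $n+k$ which contain a basis of $\mathcal M$. For $K\subset S$ put $x^K=\prod_{i\in K}x_i$ and $Z_K=Z\cap \mathrm{Vect}(e_j:j\in K)$; when $K\in\mathcal B_k$, $\dim Z_K=k$. For a basis $T$ of $\mathcal M$ and $j\in S\setminus T$, let $\gamma(T,j)$ be the unique linear combination of $e_j$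 and the $e_t$, $t\in T$, which lies in $Z$ and in which $e_j$ has coefficient $1$. Then $\mathscr Z_T=(\gamma(T,j))_{j\in S\setminus T}$ is a basis of $Z$ and, if $T\subset K\in\mathcal B_k$, $\mathscr Z_T^K=(\gamma(T,j))_{j\in K\setminus T}$ is a basis of $Z_K$. Given a basis $\mathscr Z$ of $Z$ and a basis $\mathscr Z^K$ of $Z_K$, set $$r(\mathscr Z:\mathscr Z^K)=\frac{|\det(\mathscr Z/\mathscr Z_T)|^2}{|\det(\mathscr Z^K/\mathscr Z_T^K)|^2},$$ where $T\subset K$ is a basis of $\mathcal M$ and $\det(\mathscr B_1/\mathscr B_2)$ is the determinant of the matrix of the vectors of $\mathscr B_1$ in the basis $\mathscr B_2$; this ratio does not depend on the choice of $T$. Fix a basis $\mathscr Z$ of $Z$. Let $k\ge1$ and let $\Theta$ be a $k$-dimensional subspace of $E^*$ such that $\Theta\cap\operatorname{im}\mathrm D=\{0\}$. Let $(\theta_1,\dots,\theta_k)$ be a basis of $\Theta$ and set $\vartheta=\theta_1\wedge\dots\wedge\theta_k$. For each $K\in\mathcal B_k$, let $\mathscr Z^K=(\gamma_1,\dots,\gamma_k)$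 be a basis of $Z_K$, set $z_K=\gamma_1\wedge\dots\wedge\gamma_k$, and let $(\vartheta,z_K)=\det(\theta_i(\gamma_j))_{1\le i,j\le k}$. Then the measure on $\mathcal B_k$ which assigns to each $K$ the weight $$x^K\; r(\mathscr Z:\mathscr Z^K)\;|(\vartheta,z_K)|^2$$ is not zero, and the probability measure $\mathbb P$ obtained by normalizing it is determinantal, associated with the orthogonal projection $\mathsf P$ of $E^*$ on $\operatorname{im}\mathrm D\oplus\Theta$ in the orthogonal basis $(e_i^\star)_{i\in S}$: for every $J\subset S$, the $\mathbb P$-probability that the random set $K$ contains $J$ is the determinant of the compression of $\mathsf P$ to $\mathrm{Vect}(e_i^\star:i\in J)$, that is, of the submatrix indexed by $J$ of the matrix of $\mathsf P$ in this basis. -/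

import Mathlib

noncomputable section

namespace MeasuredMatroid

open Module Submodule MeasureTheory

/-! ### Linear matroids -/

/-- The linear map `R : E → F` represents the matroid `M` on the set `S` indexing the basis `e`
of `E`: a subset `I` of `S` is independent if and only if the family `(R (e i))`, `i ∈ I`, is
linearly independent. -/
structure Represents {𝕜 S E F : Type*} [RCLike 𝕜]
    [AddCommGroup E] [Module 𝕜 E] [AddCommGroup F] [Module 𝕜 F]
    (M : Matroid S) (e : Basis S 𝕜 E) (R : E →ₗ[𝕜] F) : Prop where
  ground_eq : M.E = Set.univ
  indep_iff : ∀ I : Set S, M.Indep I ↔ LinearIndepOn 𝕜 (fun i => R (e i)) I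

/-- `K` has cardinality `n + k`, where `n` is the rank of `M`, and contains a basis of `M`. -/
def IsEnlargedBase {S : Type*} (M : Matroid S) (k : ℕ) (K : Finset S) : Prop :=
  (K.card : ℕ∞) = M.eRank + k ∧ ∃ T : Finset S, M.IsBase (T : Set S) ∧ T ⊆ K

section Circuits

variable {𝕜 S E F : Type*} [RCLike 𝕜] [Fintype S] [LinearOrder S]
  [AddCommGroup E] [Module 𝕜 E] [AddCommGroup F] [Module 𝕜 F]
  {M : Matroid S} {e : Basis S 𝕜 E} {R : E →ₗ[𝕜] F} {T : Finset S}

/-- The coordinate subspace `E_K`, spanned by the `e j` with `j ∈ K`. -/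
def coordSpan (e : Basis S 𝕜 E) (K : Finset S) : Submodule 𝕜 E :=
  span 𝕜 (e '' (K : Set S))

/-- `Z_K = ker R ∩ E_K`. -/
def kerOn (e : Basis S 𝕜 E) (R : E →ₗ[𝕜] F) (K : Finset S) : Submodule 𝕜 E :=
  LinearMap.ker R ⊓ coordSpan e K

theorem mem_coordSpan {K : Finset S} {v : E} :
    v ∈ coordSpan e K ↔ ∀ i, i ∉ K → e.repr v i = 0 := by
  rw [coordSpan, Basis.mem_span_image]
  constructor
  · intro h i hi
    by_contra hne
    exact hi (by simpa using h (Finsupp.mem_support_iff.2 hne))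
  · intro h i hi
    by_contra hni
    exact (Finsupp.mem_support_iff.1 hi) (h i (by simpa using hni))

theorem eq_zero_of_coord (h : Represents M e R) (hT : M.IsBase (T : Set S)) {v : E}
    (hv : R v = 0) (hc : ∀ i, i ∉ T → e.repr v i = 0) : v = 0 := by
  have hli := (h.indep_iff T).1 hT.indep
  have hz : ∀ i, e.repr v i = 0 := by
    intro i
    by_cases hi : i ∈ T
    · have hs : ∑ j ∈ T, e.repr v j • R (e j) = 0 := by
        rw [← hv]
        conv_rhs => rw [← e.sum_repr v, map_sum]
        simp only [map_smul]
        refine Finset.sum_subset (Finset.subset_univ _) ?_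
        intro j _ hj
        rw [hc j hj, zero_smul]
      exact (linearIndepOn_finset_iff.1 hli) _ hs i hi
    · exact hc i hi
  exact e.ext_elem (by simpa using hz)

/-- For a basis `T` of the matroid and `j ∉ T`, there is a unique element of `ker R` which is a
linear combination of `e j`, with coefficient `1`, and of the `e t`, `t ∈ T`. -/
theorem existsUnique_fundCircuit (h : Represents M e R) (hT : M.IsBase (T : Set S))
    {j : S} (hj : j ∉ T) :
    ∃! v : E, R v = 0 ∧ e.repr v j = 1 ∧ ∀ i, i ∉ T → i ≠ j → e.repr v i = 0 := by
  have hli := (h.indep_iff T).1 hT.indep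
  have hmem : R (e j) ∈ span 𝕜 ((fun i => R (e i)) '' (T : Set S)) := by
    by_contra hn
    have h2 : LinearIndepOn 𝕜 (fun i => R (e i)) (insert j (T : Set S)) := hli.insert hn
    have h3 := (h.indep_iff _).2 h2
    have h4 := hT.eq_of_subset_indep h3 (Set.subset_insert _ _)
    exact hj (by
      have : j ∈ (T : Set S) := by rw [h4]; exact Set.mem_insert _ _
      simpa using this)
  have himg : ((fun i => R (e i)) '' (T : Set S)) = R '' (e '' (T : Set S)) := by
    rw [Set.image_image]
  rw [himg, ← Submodule.map_span] at hmem
  obtain ⟨u, hu, hRu⟩ := hmem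
  have hu' := mem_coordSpan.1 (show u ∈ coordSpan e T from hu)
  refine ⟨e j - u, ⟨by rw [map_sub, hRu, sub_self], ?_, ?_⟩, ?_⟩
  · simp [hu' j hj]
  · intro i hi hij
    simp [hu' i hi, Ne.symm hij]
  · rintro w ⟨hw0, hw1, hw2⟩
    rw [← sub_eq_zero]
    refine eq_zero_of_coord h hT (by rw [map_sub, map_sub, hw0, hRu, sub_self, sub_zero]) ?_
    intro i hi
    by_cases hij : i = j
    · subst hij; simp [hw1, hu' i hi]
    · simp [hw2 i hi hij, hu' i hi, Ne.symm hij]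

/-- The vector `γ(T, j)` attached to the fundamental circuit of `j ∉ T` with respect to the
basis `T` of the matroid. -/
def fundCircuit (h : Represents M e R) (hT : M.IsBase (T : Set S)) (j : S) (hj : j ∉ T) : E :=
  (existsUnique_fundCircuit h hT hj).choose

theorem fundCircuit_spec (h : Represents M e R) (hT : M.IsBase (T : Set S)) (j : S)
    (hj : j ∉ T) :
    R (fundCircuit h hT j hj) = 0 ∧ e.repr (fundCircuit h hT j hj) j = 1 ∧
      ∀ i, i ∉ T → i ≠ j → e.repr (fundCircuit h hT j hj) i = 0 :=
  (existsUnique_fundCircuit h hT hj).choose_spec.1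

theorem fundCircuit_coord (h : Represents M e R) (hT : M.IsBase (T : Set S)) (j : S)
    (hj : j ∉ T) (i : S) (hi : i ∉ T) :
    e.repr (fundCircuit h hT j hj) i = if j = i then 1 else 0 := by
  obtain ⟨_, h1, h2⟩ := fundCircuit_spec h hT j hj
  split_ifs with hij
  · subst hij; exact h1
  · exact h2 i hi (Ne.symm hij)

/-- Circuits `γ(T, j)`, `j ∈ J`, lying in a subspace `W` of `ker R` all of whose elements have
their coordinates supported in `T ∪ J`, form a basis of `W`. -/
def circuitBasis (h : Represents M e R) (hT : M.IsBase (T : Set S)) (W : Submodule 𝕜 E)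
    (J : Finset S) (hJ : ∀ j ∈ J, j ∉ T)
    (hW : ∀ j (hj : j ∈ J), fundCircuit h hT j (hJ j hj) ∈ W)
    (hker : W ≤ LinearMap.ker R)
    (hsupp : ∀ v ∈ W, ∀ i, i ∉ T → i ∉ J → e.repr v i = 0) :
    Basis J 𝕜 W :=
  Basis.mk (v := fun j : J => (⟨fundCircuit h hT j (hJ j j.2), hW j j.2⟩ : W))
    (by
      rw [Fintype.linearIndependent_iff]
      intro g hg i
      have h1 := congrArg (fun w : W => e.repr (w : E) i) hg
      simpa [Finsupp.finsetSum_apply, fundCircuit_coord h hT _ _ (i : S) (hJ i i.2),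
        Subtype.coe_inj] using h1)
    (by
      rintro ⟨v, hv⟩ -
      have hv' : (⟨v, hv⟩ : W) = ∑ j : J, e.repr v j •
          (⟨fundCircuit h hT j (hJ j j.2), hW j j.2⟩ : W) := by
        apply Subtype.ext
        rw [← sub_eq_zero]
        refine eq_zero_of_coord h hT ?_ ?_
        · have h0 : R v = 0 := hker hv
          simp [h0, (fundCircuit_spec h hT _ _).1]
        · intro i hi
          by_cases hiJ : i ∈ J
          · have h2 : ∀ x : J, ((x : S) = i) = (x = ⟨i, hiJ⟩) := fun x => by
              rw [Subtype.ext_iff]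
            simp [fundCircuit_coord h hT _ _ i hi, h2]
          · have h3 : ∀ x : J, ((x : S) = i) = False := fun x => by
              simp only [eq_iff_iff, iff_false]
              rintro rfl
              exact hiJ x.2
            simp [fundCircuit_coord h hT _ _ i hi, h3,
              hsupp v hv i hi hiJ]
      rw [hv']
      exact Submodule.sum_mem _ fun j _ =>
        Submodule.smul_mem _ _ (Submodule.subset_span ⟨j, rfl⟩))

/-- The fundamental basis `𝒵_T = (γ(T, j))`, `j ∈ S \ T`, of `Z = ker R`. -/
def fundBasis (h : Represents M e R) (hT : M.IsBase (T : Set S)) :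
    Basis (Tᶜ : Finset S) 𝕜 (LinearMap.ker R) :=
  circuitBasis h hT (LinearMap.ker R) Tᶜ (fun _ hj => Finset.mem_compl.1 hj)
    (fun j hj => (fundCircuit_spec h hT j (Finset.mem_compl.1 hj)).1) le_rfl
    (fun _ _ _ hi hi' => absurd (Finset.mem_compl.2 hi) hi')

@[simp]
theorem fundBasis_apply (h : Represents M e R) (hT : M.IsBase (T : Set S))
    (j : (Tᶜ : Finset S)) :
    (fundBasis h hT j : E) = fundCircuit h hT j (Finset.mem_compl.1 j.2) := by
  simp [fundBasis, circuitBasis]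

/-- The basis `𝒵_T^K = (γ(T, j))`, `j ∈ K \ T`, of `Z_K`, for a basis `T ⊆ K`. -/
def fundBasisOn (h : Represents M e R) (hT : M.IsBase (T : Set S)) {K : Finset S}
    (hTK : T ⊆ K) : Basis (K \ T : Finset S) 𝕜 (kerOn e R K) :=
  circuitBasis h hT (kerOn e R K) (K \ T) (fun _ hj => (Finset.mem_sdiff.1 hj).2)
    (fun j hj => by
      have hj' := Finset.mem_sdiff.1 hj
      refine ⟨(fundCircuit_spec h hT j hj'.2).1, mem_coordSpan.2 fun i hi => ?_⟩
      exact (fundCircuit_spec h hT j hj'.2).2.2 i (fun hiT => hi (hTK hiT))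
        (fun hij => hi (hij ▸ hj'.1)))
    inf_le_left
    (fun v hv i hiT hi => mem_coordSpan.1 hv.2 i
      (fun hiK => hi (Finset.mem_sdiff.2 ⟨hiK, hiT⟩)))

@[simp]
theorem fundBasisOn_apply (h : Represents M e R) (hT : M.IsBase (T : Set S)) {K : Finset S}
    (hTK : T ⊆ K) (j : (K \ T : Finset S)) :
    (fundBasisOn h hT hTK j : E) = fundCircuit h hT j (Finset.mem_sdiff.1 j.2).2 := by
  simp [fundBasisOn, circuitBasis]

/-- `det (B / C)`: the determinant of the matrix of the vectors of the basis `B` in the basis `C`,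
where the index set of `C`, a subset of `S`, is enumerated in increasing order. -/
def basisDet {m : ℕ} {J : Finset S} {W : Submodule 𝕜 E} (B : Basis (Fin m) 𝕜 W)
    (C : Basis J 𝕜 W) : 𝕜 :=
  (C.reindex (J.orderIsoOfFin (k := m) (by
    have h1 := finrank_eq_card_basis B
    have h2 := finrank_eq_card_basis C
    simp only [Fintype.card_fin, Fintype.card_coe] at h1 h2
    omega)).toEquiv.symm).det B

/-- `|det (𝒵 / 𝒵_T)|² / |det (𝒵^K / 𝒵_T^K)|²`, for a basis `T` of the matroid contained
in `K`. -/
def ratioAt (h : Represents M e R) {b k : ℕ} (Z : Basis (Fin b) 𝕜 (LinearMap.ker R))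
    {K : Finset S} (ZK : Basis (Fin k) 𝕜 (kerOn e R K)) (hT : M.IsBase (T : Set S))
    (hTK : T ⊆ K) : ℝ :=
  ‖basisDet Z (fundBasis h hT)‖ ^ 2 / ‖basisDet ZK (fundBasisOn h hT hTK)‖ ^ 2

/-- The ratio `r(𝒵 : 𝒵^K)`, computed from some basis of the matroid contained in `K`. -/
def ratio (h : Represents M e R) {b k : ℕ} (Z : Basis (Fin b) 𝕜 (LinearMap.ker R))
    {K : Finset S} (hK : IsEnlargedBase M k K) (ZK : Basis (Fin k) 𝕜 (kerOn e R K)) : ℝ :=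
  ratioAt h Z ZK hK.2.choose_spec.1 hK.2.choose_spec.2

/-- The weight `x^K r(𝒵 : 𝒵^K) |(ϑ, z_K)|²`, with `z_K = γ_1 ∧ ⋯ ∧ γ_k` the exterior product of
the elements of the basis `𝒵^K = (γ_1, …, γ_k)` of `Z_K`. -/
def weight (h : Represents M e R) (x : S → ℝ) {b k : ℕ}
    (Z : Basis (Fin b) 𝕜 (LinearMap.ker R)) (ϑ : ⋀[𝕜]^k (Dual 𝕜 E))
    {K : Finset S} (hK : IsEnlargedBase M k K) (ZK : Basis (Fin k) 𝕜 (kerOn e R K)) : ℝ :=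
  (∏ i ∈ K, x i) * ratio h Z hK ZK *
    ‖exteriorPower.pairingDual 𝕜 E k ϑ
      (exteriorPower.ιMulti 𝕜 k fun i => (ZK i : E))‖ ^ 2

/-- The measure on subsets of `S` carried by the sets `K` of cardinality `n + k` containing a
basis of the matroid, and giving to each of them its weight. -/
def weightMeasure (h : Represents M e R) (x : S → ℝ) {b k : ℕ}
    (Z : Basis (Fin b) 𝕜 (LinearMap.ker R)) (ϑ : ⋀[𝕜]^k (Dual 𝕜 E))
    (ZK : ∀ K : Finset S, IsEnlargedBase M k K → Basis (Fin k) 𝕜 (kerOn e R K)) :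
    Measure (Finset S) :=
  Measure.sum fun K : {K : Finset S // IsEnlargedBase M k K} =>
    ENNReal.ofReal (weight h x Z ϑ K.2 (ZK K.1 K.2)) • Measure.dirac K.1

end Circuits

/-! ### Weighted inner product and determinantal measures -/

section Euclidean

variable {𝕜 S E : Type*} [RCLike 𝕜] [Fintype S] [DecidableEq S]
  [AddCommGroup E] [Module 𝕜 E]

/-- The inner product `⟪u, v⟫ = ∑ i, x i * conj (u i) * v i` on `E*`, where `u i = u (e i)` is
the coordinate of `u` on the element `e i*` of the dual basis. -/
@[reducible]
def weightedCore (e : Basis S 𝕜 E) (x : S → ℝ) (hx : ∀ i, 0 < x i) :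
    InnerProductSpace.Core 𝕜 (Dual 𝕜 E) where
  inner u v := ∑ i, (x i : 𝕜) * (starRingEnd 𝕜 (u (e i)) * v (e i))
  conj_inner_symm u v := by
    simp only [map_sum, map_mul, RCLike.conj_ofReal, RCLike.conj_conj]
    exact Finset.sum_congr rfl fun i _ => by ring
  re_inner_nonneg u := by
    simp only [map_sum, RCLike.conj_mul, RCLike.re_ofReal_mul]
    refine Finset.sum_nonneg fun i _ => mul_nonneg (hx i).le ?_
    rw [← RCLike.ofReal_pow, RCLike.ofReal_re]
    positivity
  add_left u v w := by
    simp only [LinearMap.add_apply, map_add, add_mul, mul_add, Finset.sum_add_distrib]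
  smul_left u v r := by
    simp only [LinearMap.smul_apply, smul_eq_mul, map_mul, Finset.mul_sum]
    exact Finset.sum_congr rfl fun i _ => by ring
  definite u hu := by
    have h1 : ∑ i, x i * ‖u (e i)‖ ^ 2 = 0 := by
      have h2 : ((∑ i, x i * ‖u (e i)‖ ^ 2 : ℝ) : 𝕜) = 0 := by
        rw [← hu]
        push_cast
        exact Finset.sum_congr rfl fun i _ => by rw [RCLike.conj_mul]
      exact_mod_cast h2
    rw [Finset.sum_eq_zero_iff_of_nonneg
      fun i _ => mul_nonneg (hx i).le (by positivity)] at h1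
    refine e.ext fun i => ?_
    have h3 := h1 i (Finset.mem_univ i)
    simpa [(hx i).ne'] using h3

/-- The orthogonal projection of `E*` on `H` for the weighted inner product. -/
def weightedProj (e : Basis S 𝕜 E) (x : S → ℝ) (hx : ∀ i, 0 < x i)
    (H : Submodule 𝕜 (Dual 𝕜 E)) : Dual 𝕜 E →ₗ[𝕜] Dual 𝕜 E :=
  letI : InnerProductSpace.Core 𝕜 (Dual 𝕜 E) := weightedCore e x hx
  letI : NormedAddCommGroup (Dual 𝕜 E) := InnerProductSpace.Core.toNormedAddCommGroup (𝕜 := 𝕜)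
  letI : InnerProductSpace 𝕜 (Dual 𝕜 E) := InnerProductSpace.ofCore (weightedCore e x hx).toCore
  haveI : FiniteDimensional 𝕜 (Dual 𝕜 E) := e.dualBasis.finiteDimensional_of_finite
  (H.starProjection : Dual 𝕜 E →L[𝕜] Dual 𝕜 E).toLinearMap

theorem weightedProj_mem (e : Basis S 𝕜 E) (x : S → ℝ) (hx : ∀ i, 0 < x i)
    (H : Submodule 𝕜 (Dual 𝕜 E)) (u : Dual 𝕜 E) : weightedProj e x hx H u ∈ H := by
  let : InnerProductSpace.Core 𝕜 (Dual 𝕜 E) := weightedCore e x hx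
  let : NormedAddCommGroup (Dual 𝕜 E) := InnerProductSpace.Core.toNormedAddCommGroup (𝕜 := 𝕜)
  let : InnerProductSpace 𝕜 (Dual 𝕜 E) := InnerProductSpace.ofCore (weightedCore e x hx).toCore
  have : FiniteDimensional 𝕜 (Dual 𝕜 E) := e.dualBasis.finiteDimensional_of_finite
  exact H.starProjection_apply_mem u

theorem weightedProj_inner_eq_zero (e : Basis S 𝕜 E) (x : S → ℝ) (hx : ∀ i, 0 < x i)
    (H : Submodule 𝕜 (Dual 𝕜 E)) (u v : Dual 𝕜 E) (hv : v ∈ H) :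
    ∑ i, (x i : 𝕜) *
      (starRingEnd 𝕜 ((u - weightedProj e x hx H u) (e i)) * v (e i)) = 0 := by
  let : InnerProductSpace.Core 𝕜 (Dual 𝕜 E) := weightedCore e x hx
  let : NormedAddCommGroup (Dual 𝕜 E) := InnerProductSpace.Core.toNormedAddCommGroup (𝕜 := 𝕜)
  let : InnerProductSpace 𝕜 (Dual 𝕜 E) := InnerProductSpace.ofCore (weightedCore e x hx).toCore
  have : FiniteDimensional 𝕜 (Dual 𝕜 E) := e.dualBasis.finiteDimensional_of_finite
  exact H.starProjection_inner_eq_zero u v hv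

/-- The probability measure `P` on subsets of `S` is determinantal, associated with the orthogonal
projection on `H`, in the orthogonal basis `(e i*)`: for every `J`, the probability that the random
subset contains `J` is the determinant of the compression of the projection to the span of the
`e i*`, `i ∈ J`. -/
def IsDeterminantal (e : Basis S 𝕜 E) (x : S → ℝ) (hx : ∀ i, 0 < x i)
    (H : Submodule 𝕜 (Dual 𝕜 E)) (P : Measure (Finset S)) : Prop :=
  IsProbabilityMeasure P ∧ ∀ J : Finset S,
    ((P.real {X | J ⊆ X} : ℝ) : 𝕜) =
      ((LinearMap.toMatrix e.dualBasis e.dualBasis (weightedProj e x hx H)).submatrix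
        (fun i : J => (i : S)) (fun i : J => (i : S))).det

end Euclidean

end MeasuredMatroid

end

/-! Let `A` be the matrix of values on the `e i` of a basis `(α, u)` of `im D ⊕ Θ`, with `α`
spanning `im D` and `u` spanning `Θ`. The determinantal measure of the projection on `im D ⊕ Θ`
gives `K` a mass proportional to `x^K |det A_K|²`; this follows from Cauchy–Binet with a formal
variable marking `J` (`sum_minors_of_subset`, `exists_sum_gramMinor_eq_mul_det`). It remains to
identify `|det A_K|²` with `r(𝒵 : 𝒵^K) |(ϑ, z_K)|²` up to a constant.

If `K` contains a basis `T`, column operations replace `e j`, `j ∈ K \ T`, by `γ(T, j)`. Since `α`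
vanishes on `ker R`, the determinant splits as `det α(e_T)` times `det u(γ(T, j))`
(`det_eval_sumElim`). The factor `|det α(e_T)|²` still depends on `T`; the same splitting on the
whole of `S`, with forms dual to `𝒵`, shows that it is a constant times `|det (𝒵 / 𝒵_T)|²`
(`exists_gramMinor_eq_mul_ratioAt`). If `K` contains no basis, a form in `im D` vanishes on `K` and
the minor is zero. The sum of the weighted minors is a nonzero Gram determinant, so the measure is
nonzero. -/

namespace MeasuredMatroid

/-! ### Cauchy–Binet and sums of principal minors -/

open Polynomial in
/-- The Cauchy–Binet formula, written with principal minors of the product in the other order. -/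
theorem det_mul_eq_sum_minors {m S A : Type*} [Fintype m] [DecidableEq m] [Fintype S]
    [DecidableEq S] [CommRing A] (U : Matrix m S A) (V : Matrix S m A) :
    (U * V).det = ∑ K ∈ Finset.univ.powersetCard (Fintype.card m),
      ((V * U).submatrix (Subtype.val : K → S) (Subtype.val : K → S)).det := by
  -- Both sides are the coefficient of `X ^ card m` in `det (1 + X • V * U) = det (1 + X • U * V)`.
  rw [← Matrix.coeff_det_one_add_X_smul_eq_sum_minors, Matrix.map_mul, ← Matrix.mul_smul,
    Matrix.det_one_add_mul_comm, Matrix.smul_mul, ← Matrix.map_mul,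
    ← Polynomial.coeff_det_X_add_C_card (U * V) 1, add_comm]
  simp

theorem det_submatrix_mul_diagonal {S A : Type*} [Fintype S] [DecidableEq S] [CommRing A]
    (N : Matrix S S A) (y : S → A) (K : Finset S) :
    ((N * Matrix.diagonal y).submatrix (Subtype.val : K → S) (Subtype.val : K → S)).det =
      (N.submatrix (Subtype.val : K → S) (Subtype.val : K → S)).det * ∏ i ∈ K, y i := by
  have h : (N * Matrix.diagonal y).submatrix (Subtype.val : K → S) (Subtype.val : K → S) =
      N.submatrix Subtype.val Subtype.val * Matrix.diagonal fun i : K => y i := by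
    ext i j
    simp [Matrix.mul_diagonal]
  rw [h, Matrix.det_mul, Matrix.det_diagonal, Finset.prod_coe_sort K y]

open Polynomial in
/-- If `V * W` is the projection defined by `U` and `V`, the sum of the minors of `V * U` over the
sets containing `J` is a multiple of the principal minor of `V * W` on `J`. -/
theorem sum_minors_of_subset {m S A : Type*} [Fintype m] [DecidableEq m] [Fintype S]
    [DecidableEq S] [CommRing A] (U W : Matrix m S A) (V : Matrix S m A)
    (hW : U * V * W = U) (J : Finset S) :
    ∑ K ∈ Finset.univ.powersetCard (Fintype.card m) with J ⊆ K,
      ((V * U).submatrix (Subtype.val : K → S) (Subtype.val : K → S)).det =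
    (U * V).det *
      ((V * W).submatrix (Subtype.val : J → S) (Subtype.val : J → S)).det := by
  -- Marking `J` by `X` gives the minor on `K` the factor `X ^ (K ∩ J).card`; the coefficient of
  -- degree `J.card` then selects the `K` containing `J`.
  let y : S → A[X] := fun i => if i ∈ J then X else 1
  let VJ : Matrix J m A := V.submatrix Subtype.val id
  let WJ : Matrix m J A := W.submatrix id Subtype.val
  have hWV : W.map C * Matrix.diagonal y * V.map C =
      W.map C * V.map C + ((X : A[X]) - 1) • (WJ.map C * VJ.map C) := by
    ext1 a c
    rw [Matrix.mul_apply]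
    simp only [Matrix.mul_diagonal]
    simp only [Matrix.add_apply, Matrix.mul_apply, Matrix.smul_apply,
      Matrix.map_apply, smul_eq_mul, WJ, VJ, Matrix.submatrix_apply, id]
    rw [Finset.sum_coe_sort J (fun i => C (W a i) * C (V i c)), Finset.mul_sum,
      ← Finset.sum_filter_add_sum_filter_not Finset.univ (· ∈ J),
      ← Finset.sum_filter_add_sum_filter_not Finset.univ (· ∈ J)
        (fun i => C (W a i) * C (V i c))]
    have h1 : ∑ i with i ∉ J, C (W a i) * y i * C (V i c) =
        ∑ i with i ∉ J, C (W a i) * C (V i c) :=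
      Finset.sum_congr rfl fun i hi => by simp [y, (Finset.mem_filter.1 hi).2]
    have h2 : ∑ i with i ∈ J, C (W a i) * y i * C (V i c) =
        ∑ i ∈ J, C (W a i) * X * C (V i c) := by
      rw [Finset.filter_mem_eq_inter, Finset.univ_inter]
      exact Finset.sum_congr rfl fun i hi => by simp [y, hi]
    rw [h1, h2, Finset.filter_mem_eq_inter, Finset.univ_inter, add_right_comm,
      ← Finset.sum_add_distrib]
    congr 1
    exact Finset.sum_congr rfl fun i _ => by ring
  -- `U = U * V * W` lets `U * V` factor out, and exchanging the factors in `det (1 + _)` leaves a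
  -- determinant of size `J`. Its coefficient of degree `J.card` is `det (VJ * WJ)`.
  have key : (U.map C * Matrix.diagonal y * V.map C).det =
      C (U * V).det * ((X : A[X]) • (VJ * WJ).map C + (1 - VJ * WJ).map C).det := by
    have h1 : U.map C * Matrix.diagonal y * V.map C =
        (U * V).map C * (1 + ((X : A[X]) - 1) • (WJ.map C * VJ.map C)) := by
      conv_lhs => rw [← hW, Matrix.map_mul, Matrix.mul_assoc, Matrix.mul_assoc,
        ← Matrix.mul_assoc (W.map C), hWV, Matrix.mul_add, ← Matrix.mul_assoc, ← Matrix.map_mul,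
        hW, ← Matrix.map_mul]
      rw [Matrix.mul_add, Matrix.mul_one]
    rw [h1, Matrix.det_mul, ← Matrix.smul_mul, Matrix.det_one_add_mul_comm, RingHom.map_det]
    congr 2
    rw [Matrix.mul_smul, ← Matrix.map_mul, Matrix.map_sub (C : A →+* A[X]) (map_sub C),
      Matrix.map_one (C : A →+* A[X]) (map_zero C) (map_one C), sub_smul, one_smul]
    abel
  have h3 := congrArg (fun p => p.coeff J.card) key
  simp only [coeff_C_mul] at h3
  rw [← Fintype.card_coe J, coeff_det_X_add_C_card] at h3
  have h4 : VJ * WJ = (V * W).submatrix Subtype.val Subtype.val := by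
    ext i j
    simp [VJ, WJ, Matrix.mul_apply]
  rw [← h4, ← h3, det_mul_eq_sum_minors, finsetSum_coeff, Finset.sum_filter]
  refine Finset.sum_congr rfl fun K hK => ?_
  rw [← Matrix.mul_assoc, ← Matrix.map_mul, det_submatrix_mul_diagonal, Matrix.submatrix_map,
    ← RingHom.mapMatrix_apply, ← RingHom.map_det, coeff_C_mul]
  have h5 : ∏ i ∈ K, y i = X ^ (K ∩ J).card := by
    rw [Finset.prod_ite_mem, Finset.prod_const]
  rw [h5, coeff_X_pow, Fintype.card_coe]
  have h6 : J.card = (K ∩ J).card ↔ J ⊆ K := by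
    rw [← Finset.inter_eq_right]
    exact ⟨fun h => Finset.eq_of_subset_of_card_le Finset.inter_subset_right h.le,
      fun h => by rw [h]⟩
  simp only [h6, mul_ite, mul_one, mul_zero]

/-! ### Minors of the matrix of values of linear forms -/

section Minors

open Module Submodule Matrix

variable {𝕜 S E F : Type*} [RCLike 𝕜] [AddCommGroup E] [Module 𝕜 E]

/-- The matrix of the values of a family of linear forms on the basis `e`. -/
noncomputable def evalMatrix {ι : Type*} (e : Basis S 𝕜 E) (u : ι → Dual 𝕜 E) : Matrix S ι 𝕜 :=
  Matrix.of fun i a => u a (e i)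

/-- The principal minor on `K` of the Hermitian matrix with entries
`∑ a, u a (e i) * conj (u a (e j))`. -/
noncomputable def gramMinor {ι : Type*} [Fintype ι] [DecidableEq S] (e : Basis S 𝕜 E) (u : ι → Dual 𝕜 E)
    (K : Finset S) : 𝕜 :=
  ((evalMatrix e u * (evalMatrix e u)ᴴ).submatrix
    (Subtype.val : K → S) (Subtype.val : K → S)).det

theorem gramMinor_eq_norm_sq {ι : Type*} [Fintype ι] [DecidableEq ι] [DecidableEq S]
    (e : Basis S 𝕜 E) (u : ι → Dual 𝕜 E) {K : Finset S} (f : ι ≃ K) :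
    gramMinor e u K = ((‖(Matrix.of fun a c => u a (e (f c))).det‖ ^ 2 : ℝ) : 𝕜) := by
  have h1 : ((evalMatrix e u * (evalMatrix e u)ᴴ).submatrix
      (Subtype.val : K → S) (Subtype.val : K → S)).submatrix f f =
      (Matrix.of fun a c => u a (e (f c)))ᵀ * (Matrix.of fun a c => u a (e (f c)))ᵀᴴ := by
    ext a c
    simp [evalMatrix, Matrix.mul_apply]
  rw [gramMinor, ← det_submatrix_equiv_self f, h1, det_mul, det_conjTranspose, det_transpose,
    RCLike.star_def, RCLike.mul_conj, RCLike.ofReal_pow]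

/-- The vector `c` is a relation between the rows of the square matrix of values on `K`. -/
theorem gramMinor_eq_zero {ι : Type*} [Fintype ι] [DecidableEq ι] [DecidableEq S]
    (e : Basis S 𝕜 E) (u : ι → Dual 𝕜 E) {K : Finset S} (hK : K.card = Fintype.card ι)
    {c : ι → 𝕜} (hc : c ≠ 0) (h0 : ∀ i ∈ K, ∑ a, c a * u a (e i) = 0) :
    gramMinor e u K = 0 := by
  let f : ι ≃ K := Fintype.equivOfCardEq (by rw [Fintype.card_coe, hK])
  have h1 : (Matrix.of fun a c => u a (e (f c))).det = 0 := by
    refine exists_vecMul_eq_zero_iff.1 ⟨c, hc, ?_⟩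
    funext j
    exact h0 _ (f j).2
  rw [gramMinor_eq_norm_sq e u f, h1]
  simp

variable [LinearOrder S]

theorem basisDet_ne_zero {m : ℕ} {J : Finset S} {W : Submodule 𝕜 E} (B : Basis (Fin m) 𝕜 W)
    (C : Basis J 𝕜 W) : basisDet B C ≠ 0 :=
  (Basis.isUnit_det _ B).ne_zero

/-- Multiplicativity of the determinant under change of basis. Here `s` is the increasing
enumeration used in `basisDet`, but only its bijectivity matters later. -/
theorem exists_det_eval_eq_mul_basisDet {m : ℕ} {J : Finset S} {W : Submodule 𝕜 E}
    (B : Basis (Fin m) 𝕜 W) (C : Basis J 𝕜 W) (u : Fin m → Dual 𝕜 E) :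
    ∃ s : Fin m ≃ J, (Matrix.of fun i j => u i (B j)).det =
      (Matrix.of fun i j => u i (C (s j))).det * basisDet B C := by
  have hJ : J.card = m := by
    have h1 := finrank_eq_card_basis B
    have h2 := finrank_eq_card_basis C
    simp only [Fintype.card_fin, Fintype.card_coe] at h1 h2
    omega
  refine ⟨(J.orderIsoOfFin hJ).toEquiv, ?_⟩
  rw [basisDet, Basis.det_apply, ← det_mul]
  congr 1
  ext i j
  set D := C.reindex (J.orderIsoOfFin hJ).toEquiv.symm with hD
  have h : u i ((∑ l, D.toMatrix B l j • D l : W) : E) = u i (B j) := by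
    rw [D.sum_toMatrix_smul_self B j]
  simp only [Matrix.of_apply, Matrix.mul_apply]
  rw [← h]
  simp [hD, mul_comm]

/-! ### Factorization of the minors along a basis of the matroid -/

variable [Fintype S] [AddCommGroup F] [Module 𝕜 F]
  {M : Matroid S} {e : Basis S 𝕜 E} {R : E →ₗ[𝕜] F} {T : Finset S}

theorem fundCircuit_eq_add_sum (h : Represents M e R) (hT : M.IsBase (T : Set S)) {j : S}
    (hj : j ∉ T) {ι : Type*} [Fintype ι] (t : ι ≃ T) :
    fundCircuit h hT j hj =
      e j + ∑ c, e.repr (fundCircuit h hT j hj) (t c) • e (t c) := by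
  have h1 : ∑ c, e.repr (fundCircuit h hT j hj) (t c) • e (t c) =
      ∑ i ∈ T, e.repr (fundCircuit h hT j hj) i • e i := by
    rw [t.sum_comp fun i : T => e.repr (fundCircuit h hT j hj) i • e i]
    exact Finset.sum_coe_sort T fun i => e.repr (fundCircuit h hT j hj) i • e i
  rw [h1]
  conv_lhs => rw [← e.sum_repr (fundCircuit h hT j hj), ← Finset.sum_add_sum_compl T, add_comm]
  congr 1
  rw [Finset.sum_eq_single_of_mem j (Finset.mem_compl.2 hj)]
  · rw [(fundCircuit_spec h hT j hj).2.1, one_smul]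
  · intro i hi hij
    rw [(fundCircuit_spec h hT j hj).2.2 i (Finset.mem_compl.1 hi) hij, zero_smul]

/-- Replacing the columns `e j`, `j ∉ T`, by the columns of the fundamental circuits makes the
matrix of values block triangular. -/
theorem det_eval_sumElim (h : Represents M e R) (hT : M.IsBase (T : Set S))
    {ι κ : Type*} [Fintype ι] [DecidableEq ι] [Fintype κ] [DecidableEq κ]
    (α : ι → Dual 𝕜 E) (hα : ∀ i v, R v = 0 → α i v = 0) (u : κ → Dual 𝕜 E)
    (t : ι ≃ T) (s : κ → S) (hs : ∀ j, s j ∉ T) :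
    (Matrix.of fun a c => Sum.elim α u a (e (Sum.elim (fun c => (t c : S)) s c))).det =
      (Matrix.of fun i j => α i (e (t j))).det *
        (Matrix.of fun i j => u i (fundCircuit h hT (s j) (hs j))).det := by
  let C : Matrix ι κ 𝕜 := Matrix.of fun c j => e.repr (fundCircuit h hT (s j) (hs j)) (t c)
  have hC : ∀ (w : Dual 𝕜 E) (j : κ),
      w (fundCircuit h hT (s j) (hs j)) = ∑ c, w (e (t c)) * C c j + w (e (s j)) := by
    intro w j
    conv_lhs => rw [fundCircuit_eq_add_sum h hT (hs j) t]
    rw [map_add, map_sum, add_comm]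
    simp [C, mul_comm]
  -- Right multiplication by the unipotent block matrix performs the column operations without
  -- changing the determinant. The upper right block becomes `α` evaluated on circuits, which is
  -- zero.
  have key : (Matrix.of fun a c => Sum.elim α u a (e (Sum.elim (fun c => (t c : S)) s c))) *
      fromBlocks 1 C 0 1 = fromBlocks (Matrix.of fun i j => α i (e (t j))) 0
        (Matrix.of fun i j => u i (e (t j)))
        (Matrix.of fun i j => u i (fundCircuit h hT (s j) (hs j))) := by
    have h1 : (Matrix.of fun a c => Sum.elim α u a (e (Sum.elim (fun c => (t c : S)) s c))) =
        fromBlocks (Matrix.of fun i j => α i (e (t j))) (Matrix.of fun i j => α i (e (s j)))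
          (Matrix.of fun i j => u i (e (t j))) (Matrix.of fun i j => u i (e (s j))) := by
      ext (a | a) (c | c) <;> rfl
    rw [h1, fromBlocks_multiply]
    simp only [Matrix.mul_one, Matrix.mul_zero, add_zero]
    congr 1
    · ext i j
      simpa [Matrix.mul_apply, hC] using hα i _ (fundCircuit_spec h hT (s j) (hs j)).1
    · ext i j
      simp [Matrix.mul_apply, hC]
  have h2 := congrArg Matrix.det key
  rwa [det_mul, det_fromBlocks_zero₂₁, det_one, det_one, mul_one, mul_one,
    det_fromBlocks_zero₁₂] at h2

theorem gramMinor_sumElim (h : Represents M e R) (hT : M.IsBase (T : Set S))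
    {ι κ : Type*} [Fintype ι] [DecidableEq ι] [Fintype κ] [DecidableEq κ]
    (α : ι → Dual 𝕜 E) (hα : ∀ i v, R v = 0 → α i v = 0) (u : κ → Dual 𝕜 E)
    (t : ι ≃ T) {J K : Finset S} (s : κ ≃ J) (hs : ∀ j, (s j : S) ∉ T) (hK : T ∪ J = K) :
    gramMinor e (Sum.elim α u) K = ((‖(Matrix.of fun i j => α i (e (t j))).det‖ ^ 2 *
        ‖(Matrix.of fun i j => u i (fundCircuit h hT (s j) (hs j))).det‖ ^ 2 : ℝ) : 𝕜) := by
  subst hK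
  have hTJ : Disjoint T J := Finset.disjoint_right.2 fun j hj => by
    simpa using hs (s.symm ⟨j, hj⟩)
  -- Any enumeration of `K` computes the minor; listing `T` before `J` produces the block form.
  let f : ι ⊕ κ ≃ ((T ∪ J : Finset S)) := (Equiv.sumCongr t s).trans
    (Equiv.Finset.union T J hTJ)
  have hf : ∀ c, (f c : S) = Sum.elim (fun c => (t c : S)) (fun j => (s j : S)) c := by
    rintro (c | c) <;> rfl
  rw [gramMinor_eq_norm_sq e _ f]
  simp only [hf]
  rw [det_eval_sumElim h hT α hα u t (fun j => s j) hs, norm_mul, mul_pow]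

theorem gramMinor_sumElim_mul (h : Represents M e R) (hT : M.IsBase (T : Set S))
    {ι : Type*} [Fintype ι] [DecidableEq ι] {k : ℕ}
    (α : ι → Dual 𝕜 E) (hα : ∀ i v, R v = 0 → α i v = 0) (u : Fin k → Dual 𝕜 E)
    (t : ι ≃ T) {K : Finset S} (hTK : T ⊆ K) (ZK : Basis (Fin k) 𝕜 (kerOn e R K)) :
    gramMinor e (Sum.elim α u) K * ((‖basisDet ZK (fundBasisOn h hT hTK)‖ ^ 2 : ℝ) : 𝕜) =
      ((‖(Matrix.of fun i j => α i (e (t j))).det‖ ^ 2 *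
        ‖(Matrix.of fun i j => u i (ZK j : E)).det‖ ^ 2 : ℝ) : 𝕜) := by
  obtain ⟨s, hs⟩ := exists_det_eval_eq_mul_basisDet ZK (fundBasisOn h hT hTK) u
  rw [gramMinor_sumElim h hT α hα u t s (fun j => (Finset.mem_sdiff.1 (s j).2).2)
    (Finset.union_sdiff_of_subset hTK), hs, ← RCLike.ofReal_mul, norm_mul, mul_pow]
  simp only [fundBasisOn_apply]
  rw [mul_assoc]

/-- The case `K = S`, which relates `|det α(e_T)|²` to `|det (𝒵 / 𝒵_T)|²` and so controls the
dependence on `T`. -/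
theorem gramMinor_univ_mul (h : Represents M e R) (hT : M.IsBase (T : Set S))
    {ι : Type*} [Fintype ι] [DecidableEq ι] {b : ℕ}
    (α : ι → Dual 𝕜 E) (hα : ∀ i v, R v = 0 → α i v = 0) (u : Fin b → Dual 𝕜 E)
    (t : ι ≃ T) (Z : Basis (Fin b) 𝕜 (LinearMap.ker R)) :
    gramMinor e (Sum.elim α u) Finset.univ * ((‖basisDet Z (fundBasis h hT)‖ ^ 2 : ℝ) : 𝕜) =
      ((‖(Matrix.of fun i j => α i (e (t j))).det‖ ^ 2 *
        ‖(Matrix.of fun i j => u i (Z j : E)).det‖ ^ 2 : ℝ) : 𝕜) := by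
  obtain ⟨s, hs⟩ := exists_det_eval_eq_mul_basisDet Z (fundBasis h hT) u
  rw [gramMinor_sumElim h hT α hα u t s (fun j => Finset.mem_compl.1 (s j).2)
    (Finset.union_compl T), hs, ← RCLike.ofReal_mul, norm_mul, mul_pow]
  simp only [fundBasis_apply]
  rw [mul_assoc]

/-- A basis of a subspace has a dual family of linear forms on the whole space. -/
theorem exists_dual_family {m : ℕ} {W : Submodule 𝕜 E} (B : Basis (Fin m) 𝕜 W) :
    ∃ u : Fin m → Dual 𝕜 E, (Matrix.of fun i j => u i (B j : E)).det = 1 := by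
  choose u hu using fun i => LinearMap.exists_extend (B.coord i)
  refine ⟨u, ?_⟩
  have h1 : (Matrix.of fun i j => u i (B j : E)) = 1 := by
    ext i j
    have := LinearMap.congr_fun (hu i) (B j)
    simpa [Matrix.one_apply, Finsupp.single_apply, eq_comm] using this
  rw [h1, det_one]

/-- Up to a factor which does not depend on `K`, the minors on the sets `K` are the weights. -/
theorem exists_gramMinor_eq_mul_ratioAt (h : Represents M e R) {n b : ℕ}
    (α : Fin n → Dual 𝕜 E) (hα : ∀ i v, R v = 0 → α i v = 0)
    (hn : ∀ T : Finset S, M.IsBase (T : Set S) → T.card = n)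
    (Z : Basis (Fin b) 𝕜 (LinearMap.ker R)) :
    ∃ c : 𝕜, ∀ (k : ℕ) (u : Fin k → Dual 𝕜 E) (K T : Finset S) (hT : M.IsBase (T : Set S))
      (hTK : T ⊆ K) (ZK : Basis (Fin k) 𝕜 (kerOn e R K)),
      gramMinor e (Sum.elim α u) K = c * ((ratioAt h Z ZK hT hTK *
        ‖(Matrix.of fun i j => u i (ZK j : E)).det‖ ^ 2 : ℝ) : 𝕜) := by
  obtain ⟨v, hv⟩ := exists_dual_family Z
  -- As `v` is dual to `𝒵`, this constant satisfies `c * |det (𝒵 / 𝒵_T)|² = |det α(e_T)|²` for every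
  -- basis `T`.
  refine ⟨gramMinor e (Sum.elim α v) Finset.univ, fun k u K T hT hTK ZK => ?_⟩
  let t : Fin n ≃ T := Fintype.equivOfCardEq (by simp [hn T hT])
  have h1 := gramMinor_sumElim_mul h hT α hα u t hTK ZK
  have h2 := gramMinor_univ_mul h hT α hα v t Z
  rw [hv, norm_one, one_pow, mul_one] at h2
  rw [RCLike.ofReal_mul, ← h2] at h1
  have h3 : ((‖basisDet ZK (fundBasisOn h hT hTK)‖ ^ 2 : ℝ) : 𝕜) ≠ 0 := by
    have := basisDet_ne_zero ZK (fundBasisOn h hT hTK)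
    exact_mod_cast pow_ne_zero 2 (norm_ne_zero_iff.2 this)
  rw [eq_div_of_mul_eq h3 h1, ratioAt]
  push_cast
  ring

/-- A set which contains no basis of the matroid gives a zero minor. -/
theorem gramMinor_eq_zero_of_forall_not_isBase (h : Represents M e R) {n k : ℕ}
    (α : Fin n → Dual 𝕜 E) (hspan : span 𝕜 (Set.range α) = LinearMap.range R.dualMap)
    (u : Fin k → Dual 𝕜 E) {K : Finset S} (hcard : K.card = n + k)
    (hK : ∀ T : Finset S, M.IsBase (T : Set S) → ¬ T ⊆ K) :
    gramMinor e (Sum.elim α u) K = 0 := by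
  obtain ⟨I, hI⟩ := M.exists_isBasis (K : Set S) (by rw [h.ground_eq]; exact Set.subset_univ _)
  have hIK : ∀ i ∈ K, R (e i) ∈ span 𝕜 ((fun i => R (e i)) '' I) := by
    intro i hi
    by_contra hn
    have hiI : i ∉ I := fun hiI => hn (subset_span ⟨i, hiI, rfl⟩)
    have h2 := (h.indep_iff _).2 (((h.indep_iff _).1 hI.indep).insert hn)
    have h3 := hI.eq_of_subset_indep h2 (Set.subset_insert _ _)
      (Set.insert_subset (by simpa using hi) hI.subset)
    exact hiI (h3 ▸ Set.mem_insert i I)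
  -- Otherwise the maximal independent subset `I` of `K` would be a basis of the matroid contained
  -- in `K`.
  obtain ⟨j, hj⟩ : ∃ j, R (e j) ∉ span 𝕜 ((fun i => R (e i)) '' I) := by
    by_contra! hall
    have hIb : M.IsBase I := by
      refine Matroid.isBase_iff_maximal_indep.2 ⟨hI.indep, fun J hJ hIJ j hjJ => ?_⟩
      by_contra hjI
      have h2 := (h.indep_iff _).1 (hJ.subset (Set.insert_subset hjJ hIJ))
      exact ((linearIndepOn_insert hjI).1 h2).2 (hall j)
    refine hK I.toFinite.toFinset (by simpa using hIb) fun i hi => ?_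
    exact_mod_cast hI.subset (by simpa using hi)
  -- The form `f ∘ R` lies in `im D`, is nonzero at `e j`, and vanishes at `e i` for all `i ∈ K`.
  -- Its coordinates in `α`, padded by zeros on `u`, give the row relation.
  obtain ⟨f, hf, hle⟩ := exists_le_ker_of_notMem hj
  have hmem : R.dualMap f ∈ span 𝕜 (Set.range α) := by
    rw [hspan]
    exact ⟨f, rfl⟩
  obtain ⟨c, hc⟩ := (mem_span_range_iff_exists_fun 𝕜).1 hmem
  have hval : ∀ i, ∑ a, c a * α a (e i) = f (R (e i)) := fun i => by
    have := LinearMap.congr_fun hc (e i)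
    simpa using this
  refine gramMinor_eq_zero e _ (by simpa using hcard) (c := Sum.elim c 0) ?_ ?_
  · rintro h0
    refine hf ?_
    rw [← hval]
    refine Finset.sum_eq_zero fun a _ => ?_
    have := congrFun h0 (Sum.inl a)
    simp only [Sum.elim_inl, Pi.zero_apply] at this
    rw [this, zero_mul]
  · intro i hi
    simp only [Fintype.sum_sum_type, Sum.elim_inl, Sum.elim_inr, Pi.zero_apply, zero_mul,
      Finset.sum_const_zero, add_zero]
    rw [hval]
    exact hle (hIK i hi)

end Minors

/-! ### Orthogonal projections, measures and dimensions -/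

section Determinantal

open Module Submodule Matrix MeasureTheory

/-- The sums of the weighted minors over the sets containing `J` are proportional to the principal
minors of the matrix of the orthogonal projection on the span of the linear forms. -/
theorem exists_sum_gramMinor_eq_mul_det {𝕜 S E ι : Type*} [RCLike 𝕜] [Fintype S] [DecidableEq S]
    [AddCommGroup E] [Module 𝕜 E] [Fintype ι] [DecidableEq ι]
    (e : Basis S 𝕜 E) (x : S → ℝ) (hx : ∀ i, 0 < x i) (u : ι → Dual 𝕜 E)
    (hu : LinearIndependent 𝕜 u) (H : Submodule 𝕜 (Dual 𝕜 E)) (hH : span 𝕜 (Set.range u) = H) :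
    ∃ g : 𝕜, g ≠ 0 ∧ ∀ J : Finset S,
      ∑ K ∈ Finset.univ.powersetCard (Fintype.card ι) with J ⊆ K,
        gramMinor e u K * ∏ i ∈ K, (x i : 𝕜) =
      g * ((LinearMap.toMatrix e.dualBasis e.dualBasis (weightedProj e x hx H)).submatrix
        (fun i : J => (i : S)) (fun i : J => (i : S))).det := by
  subst hH
  have hex : ∀ j, ∃ c : ι → 𝕜, ∑ a, c a • u a =
      weightedProj e x hx (span 𝕜 (Set.range u)) (e.dualBasis j) := fun j =>
    (mem_span_range_iff_exists_fun 𝕜).1 (weightedProj_mem e x hx _ _)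
  choose c hc using hex
  -- With `V = evalMatrix e u`, the product `U * V` is the Gram matrix of `u` for the weighted inner
  -- product, and the columns of `W` are coordinates of the projected `e j*`, so the projection has
  -- matrix `V * W`.
  let U : Matrix ι S 𝕜 := (evalMatrix e u)ᴴ * diagonal fun i => (x i : 𝕜)
  let W : Matrix ι S 𝕜 := Matrix.of fun a j => c j a
  have hPW : LinearMap.toMatrix e.dualBasis e.dualBasis
      (weightedProj e x hx (span 𝕜 (Set.range u))) = evalMatrix e u * W := by
    ext i j
    rw [LinearMap.toMatrix_apply, Basis.dualBasis_repr, ← hc]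
    simp [Matrix.mul_apply, evalMatrix, W, mul_comm]
  -- This says that each `e j*` minus its projection is orthogonal to every `u a`.
  have hUP : U * evalMatrix e u * W = U := by
    rw [Matrix.mul_assoc, ← hPW]
    ext a j
    have h1 := weightedProj_inner_eq_zero e x hx (span 𝕜 (Set.range u)) (e.dualBasis j) (u a)
      (subset_span ⟨a, rfl⟩)
    have h2 := congrArg (starRingEnd 𝕜) h1
    simp only [map_sum, map_mul, RCLike.conj_ofReal, RCLike.conj_conj, map_zero,
      LinearMap.sub_apply, sub_mul, mul_sub, Finset.sum_sub_distrib, sub_eq_zero] at h2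
    simp only [U, Matrix.mul_apply (N := LinearMap.toMatrix _ _ _), LinearMap.toMatrix_apply,
      Basis.dualBasis_repr, Matrix.mul_diagonal, conjTranspose_apply, evalMatrix, Matrix.of_apply,
      RCLike.star_def]
    calc _ = ∑ i, (x i : 𝕜) * (weightedProj e x hx (span 𝕜 (Set.range u)) (e.dualBasis j) (e i) *
          starRingEnd 𝕜 (u a (e i))) := Finset.sum_congr rfl fun i _ => by ring
      _ = _ := h2.symm
      _ = _ := by
        rw [Finset.sum_eq_single j]
        · simp [mul_comm]
        · intro i _ hi
          simp [hi]
        · simp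
  refine ⟨(U * evalMatrix e u).det, fun h0 => ?_, fun J => ?_⟩
  -- A left null vector of the Gram matrix also annihilates `U = U * V * W`; conjugating gives a
  -- linear relation between the `u a`.
  · obtain ⟨v, hv, hv0⟩ := exists_vecMul_eq_zero_iff.2 h0
    have h1 : v ᵥ* U = 0 := by rw [← hUP, ← vecMul_vecMul, hv0, zero_vecMul]
    have h2 : ∑ a, starRingEnd 𝕜 (v a) • u a = 0 := by
      refine e.ext fun i => ?_
      have h3 := congrArg (starRingEnd 𝕜) (congrFun h1 i)
      simp only [U, ← vecMul_vecMul, vecMul_diagonal, Pi.zero_apply, map_mul, map_zero,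
        RCLike.conj_ofReal, mul_eq_zero, RCLike.ofReal_eq_zero, (hx i).ne', or_false] at h3
      simpa [vecMul, dotProduct, evalMatrix] using h3
    refine hv (funext fun a => ?_)
    simpa using Fintype.linearIndependent_iff.1 hu _ h2 a
  · rw [hPW, ← sum_minors_of_subset U W (evalMatrix e u) hUP J]
    refine Finset.sum_congr rfl fun K _ => ?_
    rw [← Matrix.mul_assoc, det_submatrix_mul_diagonal, gramMinor]

theorem sum_smul_dirac_apply {S : Type*} [Finite S] {p : Finset S → Prop} (w : Subtype p → ℝ)
    (w' : Finset S → ℝ) (hw : ∀ K, w K = w' K) (h0 : ∀ K, ¬ p K → w' K = 0)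
    (hpos : ∀ K, 0 ≤ w' K) (A : Finset (Finset S)) :
    Measure.sum (fun K : Subtype p => ENNReal.ofReal (w K) • Measure.dirac K.1) (A : Set (Finset S))
      = ENNReal.ofReal (∑ K ∈ A, w' K) := by
  classical
  have := Fintype.ofFinite S
  have := Fintype.ofFinite (Subtype p)
  rw [Measure.sum_apply _ (Set.toFinite _).measurableSet, tsum_fintype,
    ENNReal.ofReal_sum_of_nonneg fun K _ => hpos K]
  have h1 : ∀ K : Subtype p, (ENNReal.ofReal (w K) • Measure.dirac K.1) (A : Set (Finset S)) =
      if K.1 ∈ A then ENNReal.ofReal (w' K.1) else 0 := fun K => by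
    simp [Measure.smul_apply, Set.indicator_apply, hw]
  simp only [h1]
  rw [← Finset.sum_subtype (Finset.univ.filter p) (by simp)
    fun K => if K ∈ A then ENNReal.ofReal (w' K) else 0, Finset.sum_filter,
    ← Finset.sum_subset (Finset.subset_univ A)]
  · refine Finset.sum_congr rfl fun K hK => ?_
    by_cases hp : p K <;> simp [hp, hK, h0]
  · intro K _ hK
    simp [hK]

/-- The complement of `T` indexes a basis of `ker R`, and `im D` is the annihilator of `ker R`. -/
theorem card_eq_finrank_range_dualMap {𝕜 S E F : Type*} [RCLike 𝕜] [Fintype S] [LinearOrder S]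
    [AddCommGroup E] [Module 𝕜 E] [AddCommGroup F] [Module 𝕜 F] {M : Matroid S}
    {e : Basis S 𝕜 E} {R : E →ₗ[𝕜] F} (h : Represents M e R) {T : Finset S}
    (hT : M.IsBase (T : Set S)) : T.card = finrank 𝕜 (LinearMap.range R.dualMap) := by
  have := e.finiteDimensional_of_finite
  have h1 := Subspace.finrank_add_finrank_dualAnnihilator_eq (LinearMap.ker R)
  rw [← LinearMap.range_dualMap_eq_dualAnnihilator_ker, finrank_eq_card_basis e,
    finrank_eq_card_basis (fundBasis h hT), Fintype.card_coe, ← Finset.card_compl_add_card T] at h1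
  omega

theorem linearIndependent_coe_and_span_eq {A V ι : Type*} [Ring A] [AddCommGroup V] [Module A V]
    {W : Submodule A V} (B : Basis ι A W) :
    LinearIndependent A (fun i => (B i : V)) ∧ span A (Set.range fun i => (B i : V)) = W := by
  refine ⟨B.linearIndependent.map' W.subtype W.ker_subtype, ?_⟩
  have h := congrArg (map W.subtype) B.span_eq
  rwa [map_span, ← Set.range_comp, Submodule.map_top, range_subtype] at h

theorem exists_linearIndependent_span_eq {A V : Type*} [Field A] [AddCommGroup V] [Module A V]
    [FiniteDimensional A V] (W : Submodule A V) :
    ∃ v : Fin (finrank A W) → V, LinearIndependent A v ∧ span A (Set.range v) = W :=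
  ⟨_, linearIndependent_coe_and_span_eq (finBasis A W)⟩

end Determinantal

end MeasuredMatroid

/-! ### The main theorem -/

open MeasuredMatroid in
theorem mainTheorem3 {𝕜 S E F : Type*} [RCLike 𝕜] [Fintype S] [LinearOrder S]
    [AddCommGroup E] [Module 𝕜 E] [AddCommGroup F] [Module 𝕜 F]
    (M : Matroid S) (e : Module.Basis S 𝕜 E) (R : E →ₗ[𝕜] F) (hR : Represents M e R)
    (x : S → ℝ) (hx : ∀ i, 0 < x i)
    {b : ℕ} (Z : Module.Basis (Fin b) 𝕜 (LinearMap.ker R))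
    (k : ℕ) (hk : 1 ≤ k) (Θ : Submodule 𝕜 (Module.Dual 𝕜 E))
    (hΘ : Θ ⊓ LinearMap.range R.dualMap = ⊥) (θ : Module.Basis (Fin k) 𝕜 Θ)
    (ZK : ∀ K : Finset S, IsEnlargedBase M k K → Module.Basis (Fin k) 𝕜 (kerOn e R K)) :
    (∀ (K : Finset S) (hK : IsEnlargedBase M k K) (T : Finset S)
        (hT : M.IsBase (T : Set S)) (hTK : T ⊆ K),
      ratio hR Z hK (ZK K hK) = ratioAt hR Z (ZK K hK) hT hTK) ∧
    weightMeasure hR x Z (exteriorPower.ιMulti 𝕜 k fun i => (θ i : Module.Dual 𝕜 E)) ZK ≠ 0 ∧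
    IsDeterminantal e x hx (LinearMap.range R.dualMap ⊔ Θ)
      ((weightMeasure hR x Z
          (exteriorPower.ιMulti 𝕜 k fun i => (θ i : Module.Dual 𝕜 E)) ZK Set.univ)⁻¹ •
        weightMeasure hR x Z
          (exteriorPower.ιMulti 𝕜 k fun i => (θ i : Module.Dual 𝕜 E)) ZK) := by
  classical
  have hfin := e.dualBasis.finiteDimensional_of_finite
  obtain ⟨n, hn, α, hαli, hαspan⟩ :
      ∃ n, Module.finrank 𝕜 (LinearMap.range R.dualMap) = n ∧ ∃ α : Fin n → Module.Dual 𝕜 E,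
        LinearIndependent 𝕜 α ∧ Submodule.span 𝕜 (Set.range α) = LinearMap.range R.dualMap :=
    ⟨_, rfl, exists_linearIndependent_span_eq (LinearMap.range R.dualMap)⟩
  have hcard : ∀ T : Finset S, M.IsBase (T : Set S) → T.card = n := fun T hT =>
    (card_eq_finrank_range_dualMap hR hT).trans hn
  let u : Fin k → Module.Dual 𝕜 E := fun i => θ i
  obtain ⟨huli, huspan⟩ : LinearIndependent 𝕜 u ∧ Submodule.span 𝕜 (Set.range u) = Θ :=
    linearIndependent_coe_and_span_eq θ
  have hα : ∀ i v, R v = 0 → α i v = 0 := by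
    intro i v hv
    have hi : α i ∈ LinearMap.range R.dualMap := hαspan ▸ Submodule.subset_span ⟨i, rfl⟩
    obtain ⟨f, hf⟩ := hi
    simp [← hf, hv]
  have hli : LinearIndependent 𝕜 (Sum.elim α u) :=
    hαli.sum_type huli (by rw [hαspan, huspan, disjoint_iff, inf_comm, hΘ])
  have hspan : Submodule.span 𝕜 (Set.range (Sum.elim α u)) = LinearMap.range R.dualMap ⊔ Θ := by
    rw [Set.Sum.elim_range, Submodule.span_union, hαspan, huspan]
  obtain ⟨g, hg0, hg⟩ := exists_sum_gramMinor_eq_mul_det e x hx _ hli _ hspan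
  obtain ⟨c, hc⟩ := exists_gramMinor_eq_mul_ratioAt hR α hα hcard Z
  let ϑ := exteriorPower.ιMulti 𝕜 k u
  -- Extending the weight by zero matches the vanishing of the minors on sets of cardinality `n + k`
  -- containing no basis.
  let w : Finset S → ℝ := fun K =>
    if hK : IsEnlargedBase M k K then weight hR x Z ϑ hK (ZK K hK) else 0
  have hw0 : ∀ K, 0 ≤ w K := by
    intro K
    by_cases hK : IsEnlargedBase M k K
    · simp only [w, dif_pos hK, weight, ratio, ratioAt]
      have := Finset.prod_pos fun i (_ : i ∈ K) => hx i
      positivity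
    · simp [w, hK]
  have hminor : ∀ K ∈ Finset.univ.powersetCard (Fintype.card (Fin n ⊕ Fin k)),
      gramMinor e (Sum.elim α u) K * ∏ i ∈ K, (x i : 𝕜) = c * (w K : 𝕜) := by
    intro K hK
    have hKc : K.card = n + k := by simpa using (Finset.mem_powersetCard.1 hK).2
    by_cases hKe : IsEnlargedBase M k K
    · rw [hc k u K _ hKe.2.choose_spec.1 hKe.2.choose_spec.2 (ZK K hKe)]
      simp only [w, dif_pos hKe, weight, ratio, ϑ, exteriorPower.pairingDual_ιMulti_ιMulti]
      rw [← Matrix.det_transpose]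
      have h1 : (Matrix.of fun i j => u i (ZK K hKe j : E)).transpose =
        Matrix.of fun i j => u j (ZK K hKe i : E) := rfl
      rw [h1]
      push_cast
      ring
    · rw [gramMinor_eq_zero_of_forall_not_isBase hR α hαspan u hKc]
      · simp [w, hKe]
      · refine fun T hT hTK => hKe ⟨?_, T, hT, hTK⟩
        rw [← hT.encard_eq_eRank, Set.encard_coe_eq_coe_finsetCard, hcard T hT, hKc]
        push_cast
        rfl
  have hcardK : ∀ K, IsEnlargedBase M k K → K.card = n + k := by
    rintro K ⟨h1, T, hT, -⟩
    rw [← hT.encard_eq_eRank, Set.encard_coe_eq_coe_finsetCard, hcard T hT] at h1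
    exact_mod_cast h1
  have hsum : ∀ J : Finset S, c * ((∑ K with J ⊆ K, w K : ℝ) : 𝕜) =
      g * ((LinearMap.toMatrix e.dualBasis e.dualBasis
        (weightedProj e x hx (LinearMap.range R.dualMap ⊔ Θ))).submatrix
        (fun i : J => (i : S)) (fun i : J => (i : S))).det := by
    intro J
    rw [← hg J, RCLike.ofReal_sum, Finset.mul_sum]
    symm
    refine (Finset.sum_congr rfl fun K hK => hminor K (Finset.mem_filter.1 hK).1).trans ?_
    refine Finset.sum_subset (Finset.filter_subset_filter _ (Finset.subset_univ _)) ?_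
    intro K hK hK'
    have hKe : ¬ IsEnlargedBase M k K := fun hKe => hK' (Finset.mem_filter.2
      ⟨Finset.mem_powersetCard.2 ⟨Finset.subset_univ _, by simpa using hcardK K hKe⟩,
        (Finset.mem_filter.1 hK).2⟩)
    simp [w, hKe]
  -- The case `J = ∅` equates `c` times the total mass with `g ≠ 0`, so neither `c` nor the total
  -- mass is zero.
  have htot := hsum ∅
  rw [Matrix.det_isEmpty, mul_one] at htot
  simp only [Finset.empty_subset, Finset.filter_true] at htot
  have hne : c * ((∑ K, w K : ℝ) : 𝕜) ≠ 0 := htot ▸ hg0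
  have hc0 : c ≠ 0 := left_ne_zero_of_mul hne
  have hw : (∑ K, w K) ≠ 0 := fun h0 => hne (by rw [h0]; simp)
  have hwpos : 0 < ∑ K, w K := lt_of_le_of_ne (Finset.sum_nonneg fun K _ => hw0 K) hw.symm
  have hμ : ∀ A : Finset (Finset S), weightMeasure hR x Z ϑ ZK (A : Set (Finset S)) =
      ENNReal.ofReal (∑ K ∈ A, w K) := fun A =>
    sum_smul_dirac_apply _ w (fun K => by simp [w, K.2]) (fun K hK => by simp [w, hK]) hw0 A
  have hμuniv : weightMeasure hR x Z ϑ ZK Set.univ = ENNReal.ofReal (∑ K, w K) := by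
    rw [← hμ, Finset.coe_univ]
  refine ⟨?_, ?_, ?_, ?_⟩
  · intro K hK T hT hTK
    -- For forms dual to `𝒵^K` the pairing is `1`, so the minor is `c` times the ratio, whichever
    -- `T` is used.
    obtain ⟨v, hv⟩ := exists_dual_family (ZK K hK)
    have h1 := hc k v K T hT hTK (ZK K hK)
    rw [hc k v K _ hK.2.choose_spec.1 hK.2.choose_spec.2 (ZK K hK)] at h1
    have h2 := mul_left_cancel₀ hc0 h1
    rw [hv, norm_one, one_pow, mul_one, mul_one] at h2
    exact RCLike.ofReal_injective h2
  · intro h0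
    have h1 := hμuniv
    change weightMeasure hR x Z ϑ ZK = 0 at h0
    rw [h0, MeasureTheory.Measure.coe_zero, Pi.zero_apply, eq_comm,
      ENNReal.ofReal_eq_zero] at h1
    exact h1.not_gt hwpos
  · refine ⟨?_⟩
    rw [MeasureTheory.Measure.smul_apply, smul_eq_mul]
    refine ENNReal.inv_mul_cancel ?_ ?_
    · exact hμuniv ▸ (ENNReal.ofReal_pos.2 hwpos).ne'
    · exact hμuniv ▸ ENNReal.ofReal_ne_top
  · intro J
    have hJ : {X : Finset S | J ⊆ X} = ((Finset.univ.filter (J ⊆ ·) : Finset (Finset S)) :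
        Set (Finset S)) := by
      ext X
      simp
    have hreal : ((weightMeasure hR x Z ϑ ZK Set.univ)⁻¹ • weightMeasure hR x Z ϑ ZK).real
        {X | J ⊆ X} = (∑ K, w K)⁻¹ * ∑ K with J ⊆ K, w K := by
      rw [MeasureTheory.Measure.real, MeasureTheory.Measure.smul_apply, hJ, hμ, hμuniv,
        smul_eq_mul, ENNReal.toReal_mul, ENNReal.toReal_inv, ENNReal.toReal_ofReal hwpos.le,
        ENNReal.toReal_ofReal (Finset.sum_nonneg fun K _ => hw0 K)]
    refine (congrArg (RCLike.ofReal (K := 𝕜)) hreal).trans ?_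
    have h2 := hsum J
    -- Replacing `g` by `c` times the total mass lets the unknown constant `c` cancel.
    rw [← htot, mul_assoc] at h2
    have hw' : ((∑ K, w K : ℝ) : 𝕜) ≠ 0 := by exact_mod_cast hw
    rw [RCLike.ofReal_mul, RCLike.ofReal_inv, mul_left_cancel₀ hc0 h2, inv_mul_cancel_left₀ hw']
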